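/- In $\mathbb{C}^6=\mathbb{C}^2\otimes\mathbb{C}^3$ call a vector a product state if it is of the form $a\otimes b$ with $a\in\mathbb{C}^2$, $b\in\mathbb{C}^3$. Two families $(v_i)$, $(w_j)$ of unit vectors of $\mathbb{C}^6$ are called mutually unbiased (MU) if $|\langle v_i,w_j\rangle|^2=1/6$ for all $i,j$. A product constellation $\{5,5,4\}^{\otimes}_6$ consists of two orthonormal bases $\mathcal{B}_1,\mathcal{B}_2$ of $\mathbb{C}^2\otimes\mathbb{C}^3$ that consist of product states and are MU to each other, together with a set $\mathcal{S}$ of four orthonormal product states, each of which is MU to $\mathcal{B}_1$ and to $\mathcal{B}_2$. **Lemma.** Every product constellation $\{5,5,4\}^{\otimes}_6$ extends to a triple of MU bases only by adding product states: if $(\mathcal{B}_1,\mathcal{B}_2,\mathcal{S})$ is such a constellation and $\mathcal{B}_3\supseteq\mathcal{S}$ is an orthonormal basis of $\mathbb{C}^2\otimes\mathbb{C}^3$ that is MU to both $\mathcal{B}_1$ and $\mathcal{B}_2$, then every element of $\mathcal{B}_3$ is a product state. -/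

import Mathlib

open scoped TensorProduct

/-- The Hilbert space `ℂ² ⊗ ℂ³` of dimension six, with the tensor product inner product. -/
abbrev QubitQutrit : Type :=
  EuclideanSpace ℂ (Fin 2) ⊗[ℂ] EuclideanSpace ℂ (Fin 3)

/-- A vector of `ℂ² ⊗ ℂ³` is a product vector if it is of the form `a ⊗ b`. -/
def IsProductState (ψ : QubitQutrit) : Prop :=
  ∃ (a : EuclideanSpace ℂ (Fin 2)) (b : EuclideanSpace ℂ (Fin 3)), ψ = a ⊗ₜ[ℂ] b

/-- Two families of (unit) vectors in a `d`-dimensional complex inner product space are mutually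
unbiased if `|⟨v i, w j⟩|² = 1 / d` for all `i`, `j`. -/
def MutuallyUnbiased {E ι κ : Type*} [NormedAddCommGroup E] [InnerProductSpace ℂ E]
    (v : ι → E) (w : κ → E) : Prop :=
  ∀ i j, ‖inner ℂ (v i) (w j)‖ ^ 2 = 1 / (Module.finrank ℂ E : ℝ)

/-- A product constellation `{5,5,4}` in dimension six: two mutually unbiased orthonormal bases of
product states and four orthonormal product states mutually unbiased to both bases. -/
structure IsProductConstellation554 (B₁ B₂ : OrthonormalBasis (Fin 6) ℂ QubitQutrit)
    (S : Fin 4 → QubitQutrit) : Prop where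
  product₁ : ∀ i, IsProductState (B₁ i)
  product₂ : ∀ i, IsProductState (B₂ i)
  unbiased : MutuallyUnbiased B₁ B₂
  orthonormal : Orthonormal ℂ S
  product : ∀ i, IsProductState (S i)
  unbiased₁ : MutuallyUnbiased B₁ S
  unbiased₂ : MutuallyUnbiased B₂ S

/-!
Let `(a i ⊗ b i)` be an orthonormal product basis of `ℂ² ⊗ ℂ³` and `x ⊗ y` a unit product vector
unbiased to it. By partial traces `∑ |⟪a i, x⟫|² = 3` and `∑ |⟪b i, y⟫|² = 2`, while the products of
corresponding terms are all `1 / 6`. This is the equality case of Cauchy–Schwarz, so the terms are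
constant, `1 / 2` and `1 / 3`: unbiasedness holds factor by factor (`norm_inner_sq_factors`).

On the Bloch sphere, unbiased qubit vectors span orthogonal axes. Hence the first factors of `B₁`,
of `B₂` and of `S` lie on three mutually orthogonal axes, one for each of the three families
(`coherence_eq_or_eq_neg`). Let `e 0`, `e 1` be the orthonormal qubit basis on the axis of `S`. A
vector `ψ` of `B₃` outside `S` is `e 0 ⊗ p + e 1 ⊗ q` with `p` orthogonal to the second factors of
those members of `S` that lie along `e 0`, and `q` to those along `e 1`. Suppose `p` and `q` are both
nonzero. As the second factors live in `ℂ³`, two members of `S` lie along each of `e 0` and `e 1`,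
and therefore `p` and `q` are unbiased to all the second factors of `B₁` and `B₂`
(`card_le_two_and_norm_inner_sq`).

Unbiasedness of `ψ` to `B₁` then says that its interference terms vanish: `c * ⟪p, b⟫ * ⟪b, q⟫` is
purely imaginary, where `c` is the off-diagonal entry of `|a⟩⟨a|`. The three basis vectors with
first factor parallel to a given `a` give three terms of this kind, of equal modulus, with sum
`c * ⟪p, q⟫`; since three signs cannot add up to zero, `c * ⟪p, q⟫` is a nonzero imaginary number
(`coherence_mul_inner_re_eq_zero_and_im_ne_zero`). The same holds for `B₂`, with a coefficient that
differs from `c` by a factor `± I` because the two axes are orthogonal. Both cannot be true, so `p`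
or `q` vanishes and `ψ` is a product vector.
-/

open scoped TensorProduct
open scoped ComplexConjugate

/-! ### Vectors unbiased to a product basis -/

section ProductBasis

variable {E F ι : Type*} [NormedAddCommGroup E] [InnerProductSpace ℂ E]
  [NormedAddCommGroup F] [InnerProductSpace ℂ F] [Fintype ι]
  {B : OrthonormalBasis ι ℂ (E ⊗[ℂ] F)} {a : ι → E} {b : ι → F}

/-- The partial trace over the second factor: `∑ i, |a i⟩⟨a i|` is `dim F` times the identity. -/
theorem sum_norm_inner_sq_left_eq_finrank [FiniteDimensional ℂ F]
    (hB : ∀ i, B i = a i ⊗ₜ[ℂ] b i) (hb : ∀ i, ‖b i‖ = 1) {x : E} (hx : ‖x‖ = 1) :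
    ∑ i, ‖inner ℂ (a i) x‖ ^ 2 = Module.finrank ℂ F := by
  let f := stdOrthonormalBasis ℂ F
  calc ∑ i, ‖inner ℂ (a i) x‖ ^ 2
      = ∑ i, ∑ k, ‖inner ℂ (B i) (x ⊗ₜ[ℂ] f k)‖ ^ 2 := by
        refine Finset.sum_congr rfl fun i _ => ?_
        simp_rw [hB, TensorProduct.inner_tmul, norm_mul, mul_pow]
        rw [← Finset.mul_sum, f.sum_sq_norm_inner_left, hb, one_pow, mul_one]
    _ = ∑ k, ‖x ⊗ₜ[ℂ] f k‖ ^ 2 := by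
        rw [Finset.sum_comm]
        exact Finset.sum_congr rfl fun k _ => B.sum_sq_norm_inner_right _
    _ = Module.finrank ℂ F := by simp [hx]

/-- The partial trace over the first factor: `∑ i, |b i⟩⟨b i|` is `dim E` times the identity. -/
theorem sum_norm_inner_sq_right_eq_finrank [FiniteDimensional ℂ E]
    (hB : ∀ i, B i = a i ⊗ₜ[ℂ] b i) (ha : ∀ i, ‖a i‖ = 1) {y : F} (hy : ‖y‖ = 1) :
    ∑ i, ‖inner ℂ (b i) y‖ ^ 2 = Module.finrank ℂ E := by
  let f := stdOrthonormalBasis ℂ E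
  calc ∑ i, ‖inner ℂ (b i) y‖ ^ 2
      = ∑ i, ∑ k, ‖inner ℂ (B i) (f k ⊗ₜ[ℂ] y)‖ ^ 2 := by
        refine Finset.sum_congr rfl fun i _ => ?_
        simp_rw [hB, TensorProduct.inner_tmul, norm_mul, mul_pow]
        rw [← Finset.sum_mul, f.sum_sq_norm_inner_left, ha, one_pow, one_mul]
    _ = ∑ k, ‖f k ⊗ₜ[ℂ] y‖ ^ 2 := by
        rw [Finset.sum_comm]
        exact Finset.sum_congr rfl fun k _ => B.sum_sq_norm_inner_right _
    _ = Module.finrank ℂ E := by simp [hy]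

/-- Parseval's identity for the product vectors `x ⊗ p` and `x ⊗ q`. -/
theorem inner_eq_sum_of_product (hB : ∀ i, B i = a i ⊗ₜ[ℂ] b i) {x : E} (hx : ‖x‖ = 1) (p q : F) :
    inner ℂ p q = ∑ i, (‖inner ℂ (a i) x‖ ^ 2 : ℂ) * (inner ℂ p (b i) * inner ℂ (b i) q) := by
  have h := B.sum_inner_mul_inner (x ⊗ₜ[ℂ] p) (x ⊗ₜ[ℂ] q)
  rw [TensorProduct.inner_tmul, inner_self_eq_norm_sq_to_K, hx] at h
  simp only [Complex.coe_algebraMap, Complex.ofReal_one, one_pow, one_mul] at h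
  rw [← h]
  refine Finset.sum_congr rfl fun i _ => ?_
  rw [hB, TensorProduct.inner_tmul, TensorProduct.inner_tmul, ← Complex.conj_mul',
    inner_conj_symm]
  ring

end ProductBasis

/-- The equality case of the Cauchy–Schwarz inequality `(∑ p) (∑ 1 / p) ≥ 36`. -/
theorem eq_half_of_mul_eq_sixth {p q : Fin 6 → ℝ} (hp : ∀ i, 0 ≤ p i)
    (hpq : ∀ i, p i * q i = 1 / 6) (hps : ∑ i, p i = 3) (hqs : ∑ i, q i = 2) (i : Fin 6) :
    p i = 1 / 2 ∧ q i = 1 / 3 := by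
  have hpos : ∀ i, 0 < p i := fun i => (hp i).lt_of_ne fun h => by
    have := hpq i
    rw [← h] at this
    norm_num at this
  -- With `q = 1 / (6 p)` the nonnegative terms `(p - 1 / 2) ^ 2 / p` sum to `3 - 6 + 3 = 0`.
  have key : ∀ i, p i - 1 + 3 / 2 * q i = (p i - 1 / 2) ^ 2 / p i := fun i => by
    have hq : q i = 1 / 6 / p i := eq_div_of_mul_eq (hpos i).ne' (by rw [mul_comm]; exact hpq i)
    have := (hpos i).ne'
    rw [hq]
    field_simp
    ring
  have hsum : ∑ i, (p i - 1 / 2) ^ 2 / p i = 0 := by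
    simp_rw [← key, Finset.sum_add_distrib, Finset.sum_sub_distrib, ← Finset.mul_sum, hps, hqs]
    norm_num
  have h0 := (Finset.sum_eq_zero_iff_of_nonneg
    fun i _ => div_nonneg (sq_nonneg _) (hp i)).1 hsum i (Finset.mem_univ i)
  have hpi : p i = 1 / 2 := by
    rcases div_eq_zero_iff.1 h0 with h | h
    · linarith [pow_eq_zero_iff (two_ne_zero) |>.1 h]
    · exact absurd h (hpos i).ne'
  refine ⟨hpi, ?_⟩
  have := hpq i
  rw [hpi] at this
  linarith

theorem finrank_qubitQutrit : Module.finrank ℂ QubitQutrit = 6 := by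
  simp [QubitQutrit, Module.finrank_tensorProduct]

/-- The first tensor factor `ℂ²`. -/
abbrev Qubit : Type := EuclideanSpace ℂ (Fin 2)

/-- The second tensor factor `ℂ³`. -/
abbrev Qutrit : Type := EuclideanSpace ℂ (Fin 3)

/-- A product vector that is unbiased to an orthonormal basis of product vectors is unbiased to it
in each tensor factor. -/
theorem norm_inner_sq_factors {B : OrthonormalBasis (Fin 6) ℂ QubitQutrit}
    {a : Fin 6 → Qubit} {b : Fin 6 → Qutrit}
    (hB : ∀ i, B i = a i ⊗ₜ[ℂ] b i) (ha : ∀ i, ‖a i‖ = 1) (hb : ∀ i, ‖b i‖ = 1)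
    {x : Qubit} {y : Qutrit} (hx : ‖x‖ = 1) (hy : ‖y‖ = 1)
    (h : ∀ i, ‖inner ℂ (B i) (x ⊗ₜ[ℂ] y)‖ ^ 2 = 1 / 6) (i : Fin 6) :
    ‖inner ℂ (a i) x‖ ^ 2 = 1 / 2 ∧ ‖inner ℂ (b i) y‖ ^ 2 = 1 / 3 := by
  refine eq_half_of_mul_eq_sixth (p := fun i => ‖inner ℂ (a i) x‖ ^ 2)
    (q := fun i => ‖inner ℂ (b i) y‖ ^ 2) (fun i => by positivity) (fun i => ?_) ?_ ?_ i
  · rw [← h i, hB, TensorProduct.inner_tmul, norm_mul, mul_pow]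
  · rw [sum_norm_inner_sq_left_eq_finrank hB hb hx]; simp
  · rw [sum_norm_inner_sq_right_eq_finrank hB ha hy]; simp

/-- The factors of a unit product vector may be taken to be unit vectors. -/
theorem IsProductState.exists_unit {ψ : QubitQutrit} (h : IsProductState ψ) (hψ : ‖ψ‖ = 1) :
    ∃ (a : Qubit) (b : Qutrit), ψ = a ⊗ₜ[ℂ] b ∧ ‖a‖ = 1 ∧ ‖b‖ = 1 := by
  obtain ⟨a, b, rfl⟩ := h
  rw [TensorProduct.norm_tmul] at hψ
  have ha : ‖a‖ ≠ 0 := left_ne_zero_of_mul_eq_one hψ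
  refine ⟨((‖a‖⁻¹ : ℝ) : ℂ) • a, ((‖a‖ : ℝ) : ℂ) • b, ?_, ?_, ?_⟩
  · rw [TensorProduct.smul_tmul_smul, ← Complex.ofReal_mul, inv_mul_cancel₀ ha]; simp
  · rw [norm_smul]; simp [ha]
  · rw [norm_smul]; simpa using hψ

/-! ### Overlaps in a two-dimensional space -/

section Coherence

variable {E F : Type*} [NormedAddCommGroup E] [InnerProductSpace ℂ E]
  [NormedAddCommGroup F] [InnerProductSpace ℂ F] (e : OrthonormalBasis (Fin 2) ℂ E)

/-- The off-diagonal entry `⟨e 0|x⟩⟨x|e 1⟩` of the operator `|x⟩⟨x|` in the orthonormal basis `e` of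
a two-dimensional space. For a unit vector it holds the two Bloch coordinates of `x` that are
orthogonal to the axis of `e`. -/
noncomputable def coherence (x : E) : ℂ := inner ℂ (e 0) x * inner ℂ x (e 1)

theorem norm_inner_tmul_sq (x : E) (y p q : F) :
    ‖inner ℂ (x ⊗ₜ[ℂ] y) (e 0 ⊗ₜ[ℂ] p + e 1 ⊗ₜ[ℂ] q)‖ ^ 2 =
      ‖inner ℂ x (e 0)‖ ^ 2 * ‖inner ℂ y p‖ ^ 2 + ‖inner ℂ x (e 1)‖ ^ 2 * ‖inner ℂ y q‖ ^ 2 +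
        2 * (coherence e x * (inner ℂ p y * inner ℂ y q)).re := by
  rw [inner_add_right, TensorProduct.inner_tmul, TensorProduct.inner_tmul,
    ← Complex.normSq_eq_norm_sq, Complex.normSq_add, map_mul, map_mul]
  simp_rw [← Complex.normSq_eq_norm_sq]
  congr 2
  rw [← Complex.conj_re, coherence]
  congr 1
  simp only [map_mul, inner_conj_symm]
  ring

theorem norm_inner_sq_eq_coherence (x y : E) :
    ‖inner ℂ x y‖ ^ 2 = ‖inner ℂ x (e 0)‖ ^ 2 * ‖inner ℂ (e 0) y‖ ^ 2 +
      ‖inner ℂ x (e 1)‖ ^ 2 * ‖inner ℂ (e 1) y‖ ^ 2 +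
        2 * (coherence e x * conj (coherence e y)).re := by
  rw [← e.sum_inner_mul_inner x y, Fin.sum_univ_two,
    ← Complex.normSq_eq_norm_sq, Complex.normSq_add, map_mul, map_mul]
  simp_rw [← Complex.normSq_eq_norm_sq]
  congr 2
  rw [← Complex.conj_re, coherence, coherence]
  congr 1
  simp only [map_mul, inner_conj_symm]
  ring

variable {e}

theorem norm_inner_one_sq {x : E} (hx : ‖x‖ = 1) (h0 : ‖inner ℂ x (e 0)‖ ^ 2 = 1 / 2) :
    ‖inner ℂ x (e 1)‖ ^ 2 = 1 / 2 := by
  have := e.sum_sq_norm_inner_left x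
  rw [Fin.sum_univ_two, h0, hx] at this
  linarith

theorem norm_coherence {x : E} (hx : ‖x‖ = 1) (h0 : ‖inner ℂ x (e 0)‖ ^ 2 = 1 / 2) :
    ‖coherence e x‖ = 1 / 2 := by
  rw [← sq_eq_sq₀ (norm_nonneg _) (by norm_num), coherence, norm_mul, mul_pow, norm_inner_symm, h0,
    norm_inner_one_sq hx h0]
  norm_num

/-- For `x` and `y` on the equator of the Bloch sphere with poles `e 0` and `e 1`, the overlap is
governed by the angle between the coherences. -/
theorem norm_inner_sq_eq_half_add {x y : E} (hx : ‖x‖ = 1) (hy : ‖y‖ = 1)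
    (hx0 : ‖inner ℂ x (e 0)‖ ^ 2 = 1 / 2) (hy0 : ‖inner ℂ y (e 0)‖ ^ 2 = 1 / 2) :
    ‖inner ℂ x y‖ ^ 2 = 1 / 2 + 2 * (coherence e x * conj (coherence e y)).re := by
  rw [norm_inner_sq_eq_coherence e, norm_inner_symm (e 0) y, norm_inner_symm (e 1) y, hx0, hy0,
    norm_inner_one_sq hx hx0, norm_inner_one_sq hy hy0]
  norm_num

theorem eq_or_eq_neg_of_re_mul_conj_eq_zero {c d w : ℂ} (hcd : ‖c‖ = ‖d‖) (hw : w ≠ 0)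
    (hc : (c * conj w).re = 0) (hd : (d * conj w).re = 0) : c = d ∨ c = -d := by
  have hw' : conj w ≠ 0 := by simpa using hw
  have h1 : ‖c * conj w‖ ^ 2 = ‖d * conj w‖ ^ 2 := by rw [norm_mul, norm_mul, hcd]
  rw [← Complex.normSq_eq_norm_sq, ← Complex.normSq_eq_norm_sq, Complex.normSq_apply,
    Complex.normSq_apply, hc, hd] at h1
  have h2 : (c * conj w).im = (d * conj w).im ∨ (c * conj w).im = -(d * conj w).im :=
    mul_self_eq_mul_self_iff.1 (by linarith)
  refine h2.imp (fun h => mul_right_cancel₀ hw' ?_) fun h => mul_right_cancel₀ hw' ?_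
  · exact Complex.ext (by rw [hc, hd]) h
  · exact Complex.ext (by rw [neg_mul, Complex.neg_re, hc, hd, neg_zero])
      (by rw [neg_mul, Complex.neg_im, h])

/-- Two qubit vectors that are both unbiased to each of two mutually unbiased vectors `e 0` and `z`
lie on one axis of the Bloch sphere. -/
theorem coherence_eq_or_eq_neg {x x' z : E} (hx : ‖x‖ = 1) (hx' : ‖x'‖ = 1) (hz : ‖z‖ = 1)
    (hx0 : ‖inner ℂ x (e 0)‖ ^ 2 = 1 / 2) (hx0' : ‖inner ℂ x' (e 0)‖ ^ 2 = 1 / 2)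
    (hz0 : ‖inner ℂ z (e 0)‖ ^ 2 = 1 / 2) (hxz : ‖inner ℂ x z‖ ^ 2 = 1 / 2)
    (hxz' : ‖inner ℂ x' z‖ ^ 2 = 1 / 2) :
    coherence e x = coherence e x' ∨ coherence e x = -coherence e x' := by
  refine eq_or_eq_neg_of_re_mul_conj_eq_zero (w := coherence e z) ?_ ?_ ?_ ?_
  · rw [norm_coherence hx hx0, norm_coherence hx' hx0']
  · rw [← norm_ne_zero_iff, norm_coherence hz hz0]; norm_num
  · linarith [norm_inner_sq_eq_half_add hx hz hx0 hz0]
  · linarith [norm_inner_sq_eq_half_add hx' hz hx0' hz0]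

theorem norm_inner_sq_of_coherence_eq {x x' : E} (hx : ‖x‖ = 1) (hx' : ‖x'‖ = 1)
    (hx0 : ‖inner ℂ x (e 0)‖ ^ 2 = 1 / 2) (hx0' : ‖inner ℂ x' (e 0)‖ ^ 2 = 1 / 2)
    (h : coherence e x = coherence e x') : ‖inner ℂ x x'‖ ^ 2 = 1 := by
  rw [norm_inner_sq_eq_half_add hx hx' hx0 hx0', h, Complex.mul_conj', norm_coherence hx' hx0']
  norm_cast
  norm_num

theorem norm_inner_sq_of_coherence_eq_neg {x x' : E} (hx : ‖x‖ = 1) (hx' : ‖x'‖ = 1)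
    (hx0 : ‖inner ℂ x (e 0)‖ ^ 2 = 1 / 2) (hx0' : ‖inner ℂ x' (e 0)‖ ^ 2 = 1 / 2)
    (h : coherence e x = -coherence e x') : ‖inner ℂ x x'‖ ^ 2 = 0 := by
  rw [norm_inner_sq_eq_half_add hx hx' hx0 hx0', h, neg_mul, Complex.mul_conj',
    norm_coherence hx' hx0']
  norm_cast
  norm_num

end Coherence

theorem exists_orthonormalBasis_zero_eq {x : Qubit} (hx : ‖x‖ = 1) :
    ∃ e : OrthonormalBasis (Fin 2) ℂ Qubit, e 0 = x := by
  have hv : Orthonormal ℂ (({0} : Set (Fin 2)).domRestrict fun _ => x) :=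
    ⟨fun _ => hx, fun i j hij => absurd (Subsingleton.elim i j) hij⟩
  obtain ⟨e, he⟩ := hv.exists_orthonormalBasis_extension_of_card_eq (by simp)
  exact ⟨e, he 0 rfl⟩

theorem exists_eq_tmul_add_tmul {E F : Type*} [NormedAddCommGroup E] [InnerProductSpace ℂ E]
    [NormedAddCommGroup F] [InnerProductSpace ℂ F] (e : OrthonormalBasis (Fin 2) ℂ E)
    (ψ : E ⊗[ℂ] F) : ∃ p q : F, ψ = e 0 ⊗ₜ[ℂ] p + e 1 ⊗ₜ[ℂ] q := by
  induction ψ with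
  | zero => exact ⟨0, 0, by simp⟩
  | tmul x y =>
    refine ⟨inner ℂ (e 0) x • y, inner ℂ (e 1) x • y, ?_⟩
    nth_rw 1 [← e.sum_repr' x]
    rw [Fin.sum_univ_two, TensorProduct.add_tmul, TensorProduct.smul_tmul, TensorProduct.smul_tmul]
  | add ψ φ hψ hφ =>
    obtain ⟨p, q, rfl⟩ := hψ
    obtain ⟨p', q', rfl⟩ := hφ
    refine ⟨p + p', q + q', ?_⟩
    rw [TensorProduct.tmul_add, TensorProduct.tmul_add]
    abel

/-! ### The phase constraint of a product basis -/

/-- A sum of an odd number of terms `± r` does not vanish; the weights `m` select the terms. -/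
theorem sum_mul_ne_zero_of_odd {ι : Type*} [Fintype ι] {m x : ι → ℝ} {r : ℝ} (hr : r ≠ 0)
    (hm : ∀ i, m i = 0 ∨ m i = 1) (hx : ∀ i, x i = r ∨ x i = -r) {n : ℤ} (hn : Odd n)
    (hmn : ∑ i, m i = n) : ∑ i, m i * x i ≠ 0 := by
  have hm' : ∀ i, ∃ k : ℤ, m i = k := fun i =>
    (hm i).elim (fun h => ⟨0, by simpa using h⟩) fun h => ⟨1, by simpa using h⟩
  have hx' : ∀ i, ∃ k : ℤ, x i = (2 * k + 1) * r := fun i =>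
    (hx i).elim (fun h => ⟨0, by simpa using h⟩) fun h => ⟨-1, by rw [h]; push_cast; ring⟩
  choose k hk using hm'
  choose l hl using hx'
  have hkn : ∑ i, k i = n := by
    have : ((∑ i, k i : ℤ) : ℝ) = n := by rw [← hmn]; push_cast; simp_rw [hk]
    exact_mod_cast this
  have hsum : ∑ i, m i * x i = ((2 * ∑ i, k i * l i + n : ℤ) : ℝ) * r := by
    rw [← hkn]
    push_cast
    rw [Finset.mul_sum, ← Finset.sum_add_distrib, Finset.sum_mul]
    refine Finset.sum_congr rfl fun i _ => ?_
    rw [hk, hl]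
    ring
  rw [hsum]
  refine mul_ne_zero (Int.cast_ne_zero.2 fun h => ?_) hr
  obtain ⟨c, rfl⟩ := hn
  omega

theorem eq_or_eq_neg_of_re_eq_zero {w : ℂ} {r : ℝ} (hre : w.re = 0) (hr : ‖w‖ = r) :
    w.im = r ∨ w.im = -r := by
  rw [← mul_self_eq_mul_self_iff, ← hr, Complex.norm_mul_self_eq_normSq, Complex.normSq_apply, hre]
  ring

/-- The phase constraint that one product basis puts on a vector `e 0 ⊗ p + e 1 ⊗ q` unbiased to it:
the number `⟪p, q⟫` is nonzero and its argument is fixed, up to sign, by the coherence of the first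
factors of the basis. The three basis vectors with first factor parallel to `a i` each contribute
`± r * I`, and three such terms cannot cancel. -/
theorem coherence_mul_inner_re_eq_zero_and_im_ne_zero
    {B : OrthonormalBasis (Fin 6) ℂ QubitQutrit} {a : Fin 6 → Qubit} {b : Fin 6 → Qutrit}
    (hB : ∀ i, B i = a i ⊗ₜ[ℂ] b i) (ha : ∀ i, ‖a i‖ = 1) (hb : ∀ i, ‖b i‖ = 1)
    {e : OrthonormalBasis (Fin 2) ℂ Qubit} (ha0 : ∀ i, ‖inner ℂ (a i) (e 0)‖ ^ 2 = 1 / 2)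
    (hcoh : ∀ i j, coherence e (a i) = coherence e (a j) ∨ coherence e (a i) = -coherence e (a j))
    {p q : Qutrit} (hp0 : p ≠ 0) (hq0 : q ≠ 0)
    (hp : ∀ i, ‖inner ℂ (b i) p‖ ^ 2 = ‖p‖ ^ 2 / 3)
    (hq : ∀ i, ‖inner ℂ (b i) q‖ ^ 2 = ‖q‖ ^ 2 / 3)
    (hψ : ∀ i, ‖inner ℂ (B i) (e 0 ⊗ₜ[ℂ] p + e 1 ⊗ₜ[ℂ] q)‖ ^ 2 = (‖p‖ ^ 2 + ‖q‖ ^ 2) / 6)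
    (i : Fin 6) :
    (coherence e (a i) * inner ℂ p q).re = 0 ∧ (coherence e (a i) * inner ℂ p q).im ≠ 0 := by
  set z : Fin 6 → ℂ := fun j => inner ℂ p (b j) * inner ℂ (b j) q with hz
  -- The modulus condition leaves only the interference term.
  have hzre : ∀ j, (coherence e (a j) * z j).re = 0 := fun j => by
    have h := hψ j
    rw [hB, norm_inner_tmul_sq, ha0, norm_inner_one_sq (ha j) (ha0 j), hp, hq] at h
    simp only [hz]
    linarith
  have hre : ∀ j, (coherence e (a i) * z j).re = 0 := fun j => by
    rcases hcoh i j with h | h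
    · rw [h, hzre]
    · rw [h, neg_mul, Complex.neg_re, hzre, neg_zero]
  have hnorm : ∀ j, ‖coherence e (a i) * z j‖ = 1 / 2 * (‖p‖ * ‖q‖ / 3) := fun j => by
    rw [norm_mul, norm_coherence (ha i) (ha0 i)]
    congr 1
    rw [← sq_eq_sq₀ (norm_nonneg _) (by positivity), hz, norm_mul, mul_pow, norm_inner_symm, hp, hq]
    ring
  have hr : 1 / 2 * (‖p‖ * ‖q‖ / 3) ≠ 0 := by
    have := norm_ne_zero_iff.2 hp0
    have := norm_ne_zero_iff.2 hq0
    positivity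
  -- The weights are `1` for first factors parallel to `a i` and `0` for those orthogonal to it.
  have hsum : coherence e (a i) * inner ℂ p q =
      ∑ j, ((‖inner ℂ (a j) (a i)‖ ^ 2 : ℝ) : ℂ) * (coherence e (a i) * z j) := by
    rw [inner_eq_sum_of_product hB (ha i) p q, Finset.mul_sum]
    refine Finset.sum_congr rfl fun j _ => ?_
    push_cast
    ring
  constructor
  · rw [hsum, Complex.re_sum]
    exact Finset.sum_eq_zero fun j _ => by rw [Complex.re_ofReal_mul, hre, mul_zero]
  · rw [hsum, Complex.im_sum]
    simp_rw [Complex.im_ofReal_mul]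
    refine sum_mul_ne_zero_of_odd (n := 3) hr (fun j => ?_)
      (fun j => eq_or_eq_neg_of_re_eq_zero (hre j) (hnorm j)) (by decide) ?_
    · exact (hcoh j i).symm.imp
        (norm_inner_sq_of_coherence_eq_neg (ha j) (ha i) (ha0 j) (ha0 i))
        (norm_inner_sq_of_coherence_eq (ha j) (ha i) (ha0 j) (ha0 i))
    · rw [sum_norm_inner_sq_left_eq_finrank hB hb (ha i)]
      simp

/-! ### Vectors orthogonal to an orthonormal family -/

theorem Orthonormal.option_elim {𝕜 F κ : Type*} [RCLike 𝕜] [NormedAddCommGroup F]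
    [InnerProductSpace 𝕜 F] {y : κ → F} (hy : Orthonormal 𝕜 y) {p : F} (hp : ‖p‖ = 1)
    (hpy : ∀ k, inner 𝕜 (y k) p = 0) :
    Orthonormal 𝕜 (fun o : Option κ => o.elim p y) := by
  refine ⟨fun o => ?_, fun o o' h => ?_⟩
  · cases o with
    | none => exact hp
    | some k => exact hy.1 k
  · cases o with
    | none =>
      cases o' with
      | none => exact absurd rfl h
      | some k => exact inner_eq_zero_symm.1 (hpy k)
    | some k =>
      cases o' with
      | none => exact hpy k
      | some l => exact hy.2 fun hkl => h (congrArg some hkl)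

/-- A nonzero vector orthogonal to an orthonormal family; when the two together span, it picks up
what the family leaves of the norm of any `b`. -/
theorem card_lt_and_norm_inner_sq_of_orthonormal {κ F : Type*} [Fintype κ] [NormedAddCommGroup F]
    [InnerProductSpace ℂ F] [FiniteDimensional ℂ F] {y : κ → F} (hy : Orthonormal ℂ y) {p : F}
    (hp : p ≠ 0) (hpy : ∀ k, inner ℂ (y k) p = 0) :
    Fintype.card κ + 1 ≤ Module.finrank ℂ F ∧
      (Fintype.card κ + 1 = Module.finrank ℂ F → ∀ b : F,
        ‖inner ℂ b p‖ ^ 2 = ‖p‖ ^ 2 * (‖b‖ ^ 2 - ∑ k, ‖inner ℂ b (y k)‖ ^ 2)) := by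
  have hp' : ‖p‖ ≠ 0 := norm_ne_zero_iff.2 hp
  have hon := hy.option_elim (p := ((‖p‖⁻¹ : ℝ) : ℂ) • p)
    (by rw [norm_smul]; simp [hp']) fun k => by rw [inner_smul_right, hpy, mul_zero]
  refine ⟨by simpa using hon.linearIndependent.fintype_card_le_finrank, fun hcard b => ?_⟩
  let B := (basisOfOrthonormalOfCardEqFinrank hon (by simpa using hcard)).toOrthonormalBasis
    (by simpa using hon)
  have h := B.sum_sq_norm_inner_left b
  simp only [B, Module.Basis.coe_toOrthonormalBasis, coe_basisOfOrthonormalOfCardEqFinrank,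
    Fintype.sum_option, Option.elim, inner_smul_right, norm_mul, Complex.norm_real, norm_inv,
    norm_norm, mul_pow] at h
  rw [← h]
  field_simp
  ring

/-- The members of `T` are the product vectors with first factor parallel to `e j`. If a nonzero
`p` is orthogonal to their second factors, there are at most two of them, and if there are exactly
two, `p` is unbiased to every unit vector unbiased to the second factors. -/
theorem card_le_two_and_norm_inner_sq {s : Fin 4 → Qubit} {y : Fin 4 → Qutrit}
    (hon : Orthonormal ℂ fun k => s k ⊗ₜ[ℂ] y k) (hs : ∀ k, ‖s k‖ = 1) (hy : ∀ k, ‖y k‖ = 1)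
    {e : OrthonormalBasis (Fin 2) ℂ Qubit} {j : Fin 2} {T : Finset (Fin 4)}
    (hT : ∀ k ∈ T, ∀ l ≠ j, inner ℂ (s k) (e l) = 0) {p : Qutrit} (hp : p ≠ 0)
    (hpy : ∀ k ∈ T, inner ℂ (y k) p = 0) :
    T.card ≤ 2 ∧ (T.card = 2 → ∀ b : Qutrit, ‖b‖ = 1 →
      (∀ k, ‖inner ℂ b (y k)‖ ^ 2 = 1 / 3) → ‖inner ℂ b p‖ ^ 2 = ‖p‖ ^ 2 / 3) := by
  have hne : ∀ k ∈ T, inner ℂ (s k) (e j) ≠ 0 := fun k hk h0 => by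
    have h := e.sum_sq_norm_inner_left (s k)
    rw [hs, Finset.sum_eq_zero fun l _ => ?_] at h
    · norm_num at h
    · by_cases hl : l = j
      · rw [hl, h0]; simp
      · rw [hT k hk l hl]; simp
  have hyT : Orthonormal ℂ fun k : T => y k := by
    refine ⟨fun k => hy k, fun k l hkl => ?_⟩
    have h := hon.2 (Subtype.coe_ne_coe.2 hkl)
    simp only [TensorProduct.inner_tmul] at h
    refine (mul_eq_zero.1 h).resolve_left ?_
    rw [← e.sum_inner_mul_inner, Finset.sum_eq_single j
      (fun m _ hm => by rw [hT k k.2 m hm, zero_mul]) (by simp)]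
    exact mul_ne_zero (hne k k.2) fun h => hne l l.2 (inner_eq_zero_symm.1 h)
  obtain ⟨h1, h2⟩ := card_lt_and_norm_inner_sq_of_orthonormal hyT hp fun k => hpy k k.2
  simp only [Fintype.card_coe, finrank_euclideanSpace, Fintype.card_fin] at h1 h2
  refine ⟨by omega, fun hT2 b hb hby => ?_⟩
  rw [h2 (by omega), hb]
  simp only [hby, Finset.sum_const, Finset.card_univ, Fintype.card_coe, hT2]
  ring

/-! ### Extending the constellation -/

/-- A unit vector that is unbiased to both bases of the constellation and orthogonal to its four
additional vectors is a product vector. -/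
theorem IsProductConstellation554.isProductState_of_orthogonal
    {B₁ B₂ : OrthonormalBasis (Fin 6) ℂ QubitQutrit} {S : Fin 4 → QubitQutrit}
    (hS : IsProductConstellation554 B₁ B₂ S) {ψ : QubitQutrit} (hψ : ‖ψ‖ = 1)
    (hψ₁ : ∀ i, ‖inner ℂ (B₁ i) ψ‖ ^ 2 = 1 / 6) (hψ₂ : ∀ i, ‖inner ℂ (B₂ i) ψ‖ ^ 2 = 1 / 6)
    (hSψ : ∀ k, inner ℂ (S k) ψ = 0) : IsProductState ψ := by
  choose a₁ b₁ hB₁ ha₁ hb₁ using fun i => (hS.product₁ i).exists_unit (B₁.norm_eq_one i)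
  choose a₂ b₂ hB₂ ha₂ hb₂ using fun i => (hS.product₂ i).exists_unit (B₂.norm_eq_one i)
  choose s y hsy hs hy using fun k => (hS.product k).exists_unit (hS.orthonormal.1 k)
  have mu₁ : ∀ i k, ‖inner ℂ (a₁ i) (s k)‖ ^ 2 = 1 / 2 ∧ ‖inner ℂ (b₁ i) (y k)‖ ^ 2 = 1 / 3 :=
    fun i k => norm_inner_sq_factors hB₁ ha₁ hb₁ (hs k) (hy k)
      (fun i => by rw [← hsy, hS.unbiased₁, finrank_qubitQutrit]; norm_num) i
  have mu₂ : ∀ i k, ‖inner ℂ (a₂ i) (s k)‖ ^ 2 = 1 / 2 ∧ ‖inner ℂ (b₂ i) (y k)‖ ^ 2 = 1 / 3 :=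
    fun i k => norm_inner_sq_factors hB₂ ha₂ hb₂ (hs k) (hy k)
      (fun i => by rw [← hsy, hS.unbiased₂, finrank_qubitQutrit]; norm_num) i
  have mu₁₂ : ∀ i j, ‖inner ℂ (a₁ i) (a₂ j)‖ ^ 2 = 1 / 2 :=
    fun i j => (norm_inner_sq_factors hB₁ ha₁ hb₁ (ha₂ j) (hb₂ j)
      (fun i => by rw [← hB₂, hS.unbiased, finrank_qubitQutrit]; norm_num) i).1
  have mu₂₁ : ∀ i j, ‖inner ℂ (a₂ i) (a₁ j)‖ ^ 2 = 1 / 2 :=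
    fun i j => by rw [norm_inner_symm, mu₁₂]
  obtain ⟨e, he⟩ := exists_orthonormalBasis_zero_eq (hs 0)
  have ha₁0 : ∀ i, ‖inner ℂ (a₁ i) (e 0)‖ ^ 2 = 1 / 2 := fun i => by rw [he]; exact (mu₁ i 0).1
  have ha₂0 : ∀ i, ‖inner ℂ (a₂ i) (e 0)‖ ^ 2 = 1 / 2 := fun i => by rw [he]; exact (mu₂ i 0).1
  -- The first factors of `S` lie on one Bloch axis, being unbiased to the unbiased pair
  -- `a₁ 0`, `a₂ 0`.
  have hs0 : ∀ k, ‖inner ℂ (s k) (e 0)‖ ^ 2 = 0 ∨ ‖inner ℂ (s k) (e 0)‖ ^ 2 = 1 := fun k => by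
    obtain ⟨f, hf⟩ := exists_orthonormalBasis_zero_eq (ha₁ 0)
    have hsf : ∀ k, ‖inner ℂ (s k) (f 0)‖ ^ 2 = 1 / 2 :=
      fun k => by rw [hf, norm_inner_symm, (mu₁ 0 k).1]
    have h2 : ∀ k, ‖inner ℂ (s k) (a₂ 0)‖ ^ 2 = 1 / 2 :=
      fun k => by rw [norm_inner_symm, (mu₂ 0 k).1]
    rw [he]
    exact (coherence_eq_or_eq_neg (hs k) (hs 0) (ha₂ 0) (hsf k) (hsf 0)
      (by rw [hf]; exact mu₂₁ 0 0) (h2 k) (h2 0)).symm.imp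
      (norm_inner_sq_of_coherence_eq_neg (hs k) (hs 0) (hsf k) (hsf 0))
      (norm_inner_sq_of_coherence_eq (hs k) (hs 0) (hsf k) (hsf 0))
  obtain ⟨p, q, rfl⟩ := exists_eq_tmul_add_tmul e ψ
  by_cases hp0 : p = 0
  · exact ⟨e 1, q, by simp [hp0]⟩
  by_cases hq0 : q = 0
  · exact ⟨e 0, p, by simp [hq0]⟩
  exfalso
  have hpq : ‖p‖ ^ 2 + ‖q‖ ^ 2 = 1 := by
    have h := norm_add_sq_eq_norm_sq_add_norm_sq_of_inner_eq_zero (𝕜 := ℂ) (e 0 ⊗ₜ[ℂ] p)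
      (e 1 ⊗ₜ[ℂ] q) (by rw [TensorProduct.inner_tmul, e.orthonormal.2 (by decide), zero_mul])
    simp only [hψ, TensorProduct.norm_tmul, e.norm_eq_one] at h
    linarith
  -- `T` and its complement index the members of `S` with first factor along `e 0` and `e 1`.
  set T : Finset (Fin 4) := Finset.univ.filter fun k => inner ℂ (s k) (e 1) = 0 with hTdef
  have hT : ∀ k ∈ T, inner ℂ (s k) (e 1) = 0 := fun k hk => (Finset.mem_filter.1 hk).2
  have hTc : ∀ k ∈ Tᶜ, inner ℂ (s k) (e 0) = 0 := fun k hk => by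
    have h1 : inner ℂ (s k) (e 1) ≠ 0 := by simpa [hTdef] using hk
    rcases hs0 k with h | h
    · simpa using h
    · have h' := e.sum_sq_norm_inner_left (s k)
      rw [Fin.sum_univ_two, h, hs] at h'
      exact absurd (by simpa using h') h1
  have hSψ' : ∀ k, inner ℂ (s k) (e 0) * inner ℂ (y k) p +
      inner ℂ (s k) (e 1) * inner ℂ (y k) q = 0 := fun k => by
    rw [← hSψ k, hsy, inner_add_right, TensorProduct.inner_tmul, TensorProduct.inner_tmul]
  have hs1 : ∀ k, inner ℂ (s k) (e 0) = 0 → inner ℂ (s k) (e 1) ≠ 0 := fun k h0 h1 => by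
    have h := e.sum_sq_norm_inner_left (s k)
    rw [Fin.sum_univ_two, h0, h1, hs] at h
    norm_num at h
  have hpT : ∀ k ∈ T, inner ℂ (y k) p = 0 := fun k hk => by
    have h := hSψ' k
    rw [hT k hk, zero_mul, add_zero] at h
    exact (mul_eq_zero.1 h).resolve_left fun h0 => hs1 k h0 (hT k hk)
  have hqT : ∀ k ∈ Tᶜ, inner ℂ (y k) q = 0 := fun k hk => by
    have h := hSψ' k
    rw [hTc k hk, zero_mul, zero_add] at h
    exact (mul_eq_zero.1 h).resolve_left (hs1 k (hTc k hk))
  have hon : Orthonormal ℂ fun k => s k ⊗ₜ[ℂ] y k := by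
    simpa only [← hsy] using hS.orthonormal
  obtain ⟨hT2, hp⟩ := card_le_two_and_norm_inner_sq hon hs hy (j := 0)
    (fun k hk l hl => by rw [Fin.eq_one_of_ne_zero l hl]; exact hT k hk) hp0 hpT
  obtain ⟨hTc2, hq⟩ := card_le_two_and_norm_inner_sq hon hs hy (j := 1)
    (fun k hk l hl => by rw [show l = 0 by omega]; exact hTc k hk) hq0 hqT
  have hcard := Finset.card_add_card_compl T
  rw [Fintype.card_fin] at hcard
  -- Neither `T` nor its complement has more than two of the four indices, so both have two.
  replace hp := hp (by omega)
  replace hq := hq (by omega)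
  have hc₁ : ∀ i j, coherence e (a₁ i) = coherence e (a₁ j) ∨
      coherence e (a₁ i) = -coherence e (a₁ j) := fun i j =>
    coherence_eq_or_eq_neg (ha₁ i) (ha₁ j) (ha₂ 0) (ha₁0 i) (ha₁0 j) (ha₂0 0) (mu₁₂ i 0) (mu₁₂ j 0)
  have hc₂ : ∀ i j, coherence e (a₂ i) = coherence e (a₂ j) ∨
      coherence e (a₂ i) = -coherence e (a₂ j) := fun i j =>
    coherence_eq_or_eq_neg (ha₂ i) (ha₂ j) (ha₁ 0) (ha₂0 i) (ha₂0 j) (ha₁0 0) (mu₂₁ i 0) (mu₂₁ j 0)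
  obtain ⟨hre₁, him₁⟩ := coherence_mul_inner_re_eq_zero_and_im_ne_zero hB₁ ha₁ hb₁ ha₁0 hc₁ hp0 hq0
    (fun i => hp _ (hb₁ i) fun k => (mu₁ i k).2) (fun i => hq _ (hb₁ i) fun k => (mu₁ i k).2)
    (fun i => by rw [hψ₁, hpq]) 0
  obtain ⟨hre₂, him₂⟩ := coherence_mul_inner_re_eq_zero_and_im_ne_zero hB₂ ha₂ hb₂ ha₂0 hc₂ hp0 hq0
    (fun i => hp _ (hb₂ i) fun k => (mu₂ i k).2) (fun i => hq _ (hb₂ i) fun k => (mu₂ i k).2)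
    (fun i => by rw [hψ₂, hpq]) 0
  -- The first factors of the two bases are unbiased, so their coherences differ by a factor `± I`;
  -- multiplying `⟪p, q⟫` by either one cannot give a nonzero imaginary number both times.
  have hperp : (coherence e (a₁ 0) * conj (coherence e (a₂ 0))).re = 0 := by
    linarith [norm_inner_sq_eq_half_add (ha₁ 0) (ha₂ 0) (ha₁0 0) (ha₂0 0), mu₁₂ 0 0]
  have hprod : (coherence e (a₁ 0) * inner ℂ p q * conj (coherence e (a₂ 0) * inner ℂ p q)).re =
      0 := by
    rw [map_mul, mul_mul_mul_comm, Complex.mul_conj, Complex.re_mul_ofReal, hperp, zero_mul]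
  rw [Complex.mul_re, Complex.conj_re, Complex.conj_im, hre₁, hre₂] at hprod
  exact mul_ne_zero him₁ him₂ (by linarith)

theorem mainTheorem2 (B₁ B₂ : OrthonormalBasis (Fin 6) ℂ QubitQutrit) (S : Fin 4 → QubitQutrit)
    (hS : IsProductConstellation554 B₁ B₂ S)
    (B₃ : OrthonormalBasis (Fin 6) ℂ QubitQutrit)
    (hext : Set.range S ⊆ Set.range B₃)
    (h₁₃ : MutuallyUnbiased B₁ B₃) (h₂₃ : MutuallyUnbiased B₂ B₃) :
    ∀ k, IsProductState (B₃ k) := by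
  intro k
  by_cases hk : B₃ k ∈ Set.range S
  · obtain ⟨l, hl⟩ := hk
    exact hl ▸ hS.product l
  · refine hS.isProductState_of_orthogonal (B₃.norm_eq_one k) (fun i => ?_) (fun i => ?_)
      fun l => ?_
    · rw [h₁₃, finrank_qubitQutrit]; norm_num
    · rw [h₂₃, finrank_qubitQutrit]; norm_num
    · obtain ⟨m, hm⟩ := hext ⟨l, rfl⟩
      rw [← hm]
      refine B₃.orthonormal.2 fun hmk => hk ⟨l, ?_⟩
      rw [← hm, hmk]
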